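/- Let $\mathbf{W}$ be the category whose objects are the archimedean (abelian) lattice-ordered groups $G$ with a designated weak order unit $1$ (that is, $1\ge 0$, and $g\wedge 1=0$ implies $g=0$ for $g\ge 0$), and whose morphisms are the lattice-ordered group homomorphisms preserving the designated units. Write $n$ also for the multiple $n\cdot 1\in G$. Let $G$ be a $\mathbf{W}$-object and $f\in G$. Then $f$ is the pointwise join of its truncates $f\wedge n$, $n\in\mathbb{N}$, in both of the following senses. (i) For every $\mathbf{W}$-object $H$ and every $\mathbf{W}$-morphism $\theta:G\to H$, $\theta(f)$ is the supremum in $H$ of $\{\theta(f\wedge n):n\in\mathbb{N}\}$. (ii) In the complete lattice $\mathcal{M}G$ of $\mathbf{W}$-kernels of $G$ (the kernels of $\mathbf{W}$-morphisms out of $G$, ordered by inclusion), $\widehat{f}(r,\infty)=\bigvee_{n\in\mathbb{N}}\widehat{f\wedge n}\,(r,\infty)$ for every $r\in\mathbb{R}$. Here $\widehat{g}(r,\infty)=[(g-r)^+]$ is the $\mathbf{W}$-kernel generated by $(g-r)^+$, which is understood as follows when $r$ is not a constant of $G$: $\widehat{g}(r,\infty)$ is the join in $\mathcal{M}G$ of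 the $\mathbf{W}$-kernels generated by the elements $(qg-p\cdot 1)^+$, over integers $p$ and $q>0$ with $p/q\ge r$. -/

import Mathlib

universe u v w

/-- A `W`-object: an archimedean (abelian) lattice-ordered group with a designated weak order
unit. The trivial group is allowed. -/
class WObject (G : Type u) extends AddCommGroup G, Lattice G, IsOrderedAddMonoid G where
  /-- the designated weak order unit, written `1` in the mathematical literature -/
  unit : G
  unit_nonneg : 0 ≤ unit
  eq_zero_of_inf_unit : ∀ g : G, 0 ≤ g → g ⊓ unit = 0 → g = 0
  arch : ∀ f g : G, 0 ≤ f → (∀ n : ℕ, n • f ≤ g) → f = 0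

/-- A `W`-morphism: a homomorphism of lattice-ordered groups preserving the designated unit. -/
structure WHom (G : Type u) (H : Type v) [WObject G] [WObject H] extends G →+ H where
  map_sup' : ∀ a b : G, toFun (a ⊔ b) = toFun a ⊔ toFun b
  map_inf' : ∀ a b : G, toFun (a ⊓ b) = toFun a ⊓ toFun b
  map_unit' : toFun WObject.unit = WObject.unit

/-- Products of `W`-objects, with the pointwise operations and order. -/
instance WObject.pi {ι : Type v} (H : ι → Type w) [∀ i, WObject (H i)] :
    WObject (∀ i, H i) where
  unit := fun _ => WObject.unit
  unit_nonneg := fun _ => WObject.unit_nonneg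
  eq_zero_of_inf_unit := fun g hg h => funext fun i =>
    WObject.eq_zero_of_inf_unit (g i) (hg i) (congrFun h i)
  arch := fun f g hf h => funext fun i => WObject.arch (f i) (g i) (hf i) fun n => h n i

section Kernels

variable {G : Type u} [WObject G]

/-- A `W`-kernel of `G`: the kernel of some `W`-morphism out of `G`. (Every such subgroup is the
kernel of the quotient map onto its image, so codomains in the universe of `G` suffice.) -/
def IsWKernel (K : AddSubgroup G) : Prop :=
  ∃ (H : Type u) (_ : WObject H) (θ : WHom G H), θ.toAddMonoidHom.ker = K

/-- Any intersection of `W`-kernels is a `W`-kernel. -/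
theorem isWKernel_sInf (S : Set (AddSubgroup G)) (hS : ∀ K ∈ S, IsWKernel K) :
    IsWKernel (sInf S) := by
  have h' : ∀ K : S, IsWKernel K.1 := fun K => hS K.1 K.2
  choose H hH θ hθ using h'
  refine ⟨∀ K : S, H K, WObject.pi H,
    { toFun := fun g K => (θ K).toFun g
      map_zero' := funext fun K => (θ K).map_zero'
      map_add' := fun a b => funext fun K => (θ K).map_add' a b
      map_sup' := fun a b => funext fun K => (θ K).map_sup' a b
      map_inf' := fun a b => funext fun K => (θ K).map_inf' a b
      map_unit' := funext fun K => (θ K).map_unit' }, ?_⟩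
  ext g
  have key : ∀ K : S, (θ K).toFun g = 0 ↔ g ∈ K.1 := fun K => by
    rw [← hθ K]; exact Iff.rfl
  rw [AddSubgroup.mem_sInf]
  constructor
  · intro hg K hK
    exact (key ⟨K, hK⟩).1 (congrFun hg ⟨K, hK⟩)
  · intro hg
    exact funext fun K => (key K).2 (hg K.1 K.2)

end Kernels

/-- The Madden frame of `G`: the `W`-kernels of `G`. -/
def MaddenFrame (G : Type u) [WObject G] : Type u :=
  {K : AddSubgroup G // IsWKernel K}

namespace MaddenFrame

variable {G : Type u} [WObject G]

/-- The Madden frame is ordered by inclusion. -/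
instance : PartialOrder (MaddenFrame G) :=
  inferInstanceAs (PartialOrder {K : AddSubgroup G // IsWKernel K})

/-- Infima are intersections. -/
instance : InfSet (MaddenFrame G) :=
  ⟨fun S => ⟨sInf (Subtype.val '' S), isWKernel_sInf _ (by rintro _ ⟨K, -, rfl⟩; exact K.2)⟩⟩

/-- The complete lattice of `W`-kernels; joins are the `W`-kernels generated by unions. -/
noncomputable instance : CompleteLattice (MaddenFrame G) :=
  completeLatticeOfInf (MaddenFrame G) fun S =>
    ⟨fun K hK => (sInf_le (Set.mem_image_of_mem Subtype.val hK) :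
        sInf (Subtype.val '' S) ≤ K.1),
      fun K hK => (le_sInf (by rintro _ ⟨L, hL, rfl⟩; exact hK hL) :
        K.1 ≤ sInf (Subtype.val '' S))⟩

/-- `[S]`: the `W`-kernel generated by a subset `S` of `G`. -/
def generate (S : Set G) : MaddenFrame G :=
  sInf {K | S ⊆ (K.1 : Set G)}

/-- The value `ĝ(r, ∞) = [(g - r)⁺]` of the Madden representation of `g` on the right ray
`(r, ∞)`. For rational `r = p / q`, the `W`-kernel `[(g - r)⁺]` is `[(q g - p)⁺]`, which makes
sense although `G` need not contain the constant `r`; for arbitrary real `r` it is the join of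
the values at the rationals `p / q ≥ r`. -/
noncomputable def ray (g : G) (r : ℝ) : MaddenFrame G :=
  ⨆ (p : ℤ) (q : ℕ) (_ : 0 < q) (_ : r ≤ (p : ℝ) / (q : ℝ)),
    generate {(q • g - p • WObject.unit) ⊔ 0}

end MaddenFrame

section PointwiseSup

variable {G : Type u} [WObject G]

/-- `f₀` is the pointwise supremum of `F` in the Madden representation of `G`:
`f̂₀(r, ∞) = ⋁_{f ∈ F} f̂(r, ∞)` holds in the Madden frame for all real `r`. -/
def IsMaddenPointwiseSup (F : Set G) (f₀ : G) : Prop :=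
  ∀ r : ℝ, MaddenFrame.ray f₀ r = ⨆ f ∈ F, MaddenFrame.ray f r

/-- `f₀` is the pointwise supremum of `F` in the algebraic sense:
`θ(f₀) = ⋁ θ[F]` for every `W`-morphism `θ` out of `G`. -/
def IsPointwiseSup (F : Set G) (f₀ : G) : Prop :=
  ∀ (H : Type v) [WObject H] (θ : WHom G H), IsLUB (θ.toFun '' F) (θ.toFun f₀)

end PointwiseSup

section TruncationSup

variable {H : Type v} [WObject H]

/-! In any `W`-object an upper bound `h` of all truncates `g ∧ n` bounds `g`: the gap `d = (g - h)⁺`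
can be added to each truncate without leaving `g`, so `n(d ∧ 1)` stays bounded, whence `d ∧ 1 = 0`
by the archimedean property and `d = 0` by the weak unit. Unit-preserving morphisms commute with
truncation, so (i) is this fact in the codomain. For (ii), the join of the truncates' rays is itself
the kernel of some `W`-morphism; the same fact, extended to multiples `q • g`, applies in its
codomain. -/

theorem WObject.le_of_forall_inf_nsmul_unit_le {g h : H}
    (hg : ∀ n : ℕ, g ⊓ n • (WObject.unit : H) ≤ h) : g ≤ h := by
  set u : H := WObject.unit
  set d : H := g - h ⊓ g with hd
  have hd0 : 0 ≤ d := sub_nonneg.2 inf_le_right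
  have hstep : ∀ n : ℕ, g ⊓ n • u + d ≤ g := fun n => by
    have h1 : g ⊓ n • u ≤ h ⊓ g := le_inf (hg n) inf_le_left
    calc g ⊓ n • u + d ≤ h ⊓ g + d := by gcongr
      _ = g := by rw [hd]; abel
  -- The summand `g ⊓ 0` is the truncate at `n = 0`; it is needed since `g` may have a negative
  -- part. In the induction, `d ⊓ u` is bounded by `d` to stay below `g` and by `u` to stay below
  -- `(n + 1) • u`.
  have hbound : ∀ n : ℕ, g ⊓ 0 + n • (d ⊓ u) ≤ g ⊓ n • u := by
    intro n
    induction n with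
    | zero => simp
    | succ n ih =>
      rw [succ_nsmul, ← add_assoc]
      refine le_inf ?_ ?_
      · exact (add_le_add ih inf_le_left).trans (hstep n)
      · rw [succ_nsmul]
        exact add_le_add (ih.trans inf_le_right) inf_le_right
  have he : d ⊓ u = 0 := by
    refine WObject.arch _ (g - g ⊓ 0) (le_inf hd0 WObject.unit_nonneg) fun n => ?_
    rw [le_sub_iff_add_le']
    exact (hbound n).trans inf_le_left
  have hzero : g - h ⊓ g = 0 := WObject.eq_zero_of_inf_unit d hd0 he
  rw [sub_eq_zero.1 hzero]
  exact inf_le_left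

theorem WObject.nsmul_le_of_forall_nsmul_inf_nsmul_unit_le {g : H} (q : ℕ) :
    ∀ {h : H}, (∀ n : ℕ, q • (g ⊓ n • (WObject.unit : H)) ≤ h) → q • g ≤ h := by
  induction q with
  | zero => intro h hq; simpa using hq 0
  | succ q ih =>
    intro h hq
    have hmono : Monotone fun n : ℕ => g ⊓ n • (WObject.unit : H) := fun m n hmn =>
      inf_le_inf_left g (nsmul_le_nsmul_left WObject.unit_nonneg hmn)
    -- Decoupling the two indices lets the joins over `n` and over `m` be taken one at a time.
    have hmn : ∀ m n : ℕ,
        q • (g ⊓ n • (WObject.unit : H)) + g ⊓ m • WObject.unit ≤ h := fun m n => by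
      refine le_trans ?_ (hq (max m n))
      rw [succ_nsmul]
      exact add_le_add (nsmul_le_nsmul_right (hmono (le_max_right m n)) q)
        (hmono (le_max_left m n))
    have hg : g ≤ h - q • g := WObject.le_of_forall_inf_nsmul_unit_le fun m => by
      rw [le_sub_iff_add_le, ← le_sub_iff_add_le']
      exact ih fun n => le_sub_iff_add_le.2 (hmn m n)
    rw [succ_nsmul]
    exact le_sub_iff_add_le'.1 hg

end TruncationSup

namespace WHom

variable {G : Type u} {H : Type v} [WObject G] [WObject H]

theorem map_inf_nsmul_unit (θ : WHom G H) (f : G) (n : ℕ) :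
    θ.toFun (f ⊓ n • WObject.unit) = θ.toFun f ⊓ n • WObject.unit := by
  rw [θ.map_inf']
  congr 1
  exact (map_nsmul θ.toAddMonoidHom n _).trans (congrArg (n • ·) θ.map_unit')

theorem map_posPart_eq_zero_iff (θ : WHom G H) (g : G) (p : ℤ) (q : ℕ) :
    θ.toFun ((q • g - p • WObject.unit) ⊔ 0) = 0 ↔
      q • θ.toFun g ≤ p • (WObject.unit : H) := by
  have h : θ.toFun (q • g - p • WObject.unit) =
      q • θ.toFun g - p • (WObject.unit : H) := by
    rw [← θ.map_unit']
    change θ.toAddMonoidHom _ = q • θ.toAddMonoidHom g - p • θ.toAddMonoidHom WObject.unit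
    rw [map_sub, map_nsmul, map_zsmul]
  have h0 : θ.toFun 0 = 0 := θ.map_zero'
  rw [θ.map_sup', h, h0, sup_eq_right, sub_nonpos]

theorem monotone_toFun (θ : WHom G H) : Monotone θ.toFun := fun a b hab => by
  rw [← sup_eq_right, ← θ.map_sup', sup_eq_right.2 hab]

end WHom

namespace MaddenFrame

variable {G : Type u} [WObject G]

theorem subset_generate (S : Set G) : S ⊆ ((generate S).1 : Set G) := fun x hx => by
  change x ∈ sInf (Subtype.val '' {K : MaddenFrame G | S ⊆ (K.1 : Set G)})
  rw [AddSubgroup.mem_sInf]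
  rintro _ ⟨K, hK, rfl⟩
  exact hK hx

theorem generate_singleton_le_iff {x : G} {K : MaddenFrame G} :
    generate {x} ≤ K ↔ x ∈ K.1 :=
  ⟨fun h => h (subset_generate {x} rfl), fun h => sInf_le (Set.singleton_subset_iff.2 h)⟩

theorem ray_le_iff {g : G} {r : ℝ} {K : MaddenFrame G} :
    ray g r ≤ K ↔ ∀ (p : ℤ) (q : ℕ), 0 < q → r ≤ (p : ℝ) / (q : ℝ) →
      (q • g - p • WObject.unit) ⊔ 0 ∈ K.1 := by
  simp only [ray, iSup_le_iff, generate_singleton_le_iff]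

/-- A ray lies below a `W`-kernel exactly when the quotient by that kernel bounds the element. -/
theorem ray_le_iff_of_ker_eq {H : Type v} [WObject H] {K : MaddenFrame G} {θ : WHom G H}
    (hθ : θ.toAddMonoidHom.ker = K.1) {g : G} {r : ℝ} :
    ray g r ≤ K ↔ ∀ (p : ℤ) (q : ℕ), 0 < q → r ≤ (p : ℝ) / (q : ℝ) →
      q • θ.toFun g ≤ p • (WObject.unit : H) := by
  simp only [ray_le_iff, ← hθ, ← θ.map_posPart_eq_zero_iff]
  exact Iff.rfl

theorem ray_mono {f g : G} (hfg : f ≤ g) (r : ℝ) : ray f r ≤ ray g r := by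
  -- With the larger ray itself as kernel, the bounds on the image of `g` hold automatically.
  obtain ⟨H, _, θ, hθ⟩ := (ray g r).2
  rw [ray_le_iff_of_ker_eq hθ]
  intro p q hq hr
  exact (nsmul_le_nsmul_right (θ.monotone_toFun hfg) q).trans
    ((ray_le_iff_of_ker_eq hθ).1 le_rfl p q hq hr)

end MaddenFrame

theorem isPointwiseSup_truncates {G : Type u} [WObject G] (f : G) :
    IsPointwiseSup.{u, v} (Set.range fun n : ℕ => f ⊓ n • (WObject.unit : G)) f := by
  intro H _ θ
  refine ⟨?_, fun h hh => WObject.le_of_forall_inf_nsmul_unit_le fun n => ?_⟩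
  · rintro _ ⟨_, ⟨n, rfl⟩, rfl⟩
    exact θ.monotone_toFun inf_le_left
  · rw [← θ.map_inf_nsmul_unit]
    exact hh ⟨_, ⟨n, rfl⟩, rfl⟩

theorem isMaddenPointwiseSup_truncates {G : Type u} [WObject G] (f : G) :
    IsMaddenPointwiseSup (Set.range fun n : ℕ => f ⊓ n • (WObject.unit : G)) f := by
  intro r
  rw [iSup_range]
  refine le_antisymm ?_ (iSup_le fun n => MaddenFrame.ray_mono inf_le_left r)
  set L := ⨆ n : ℕ, MaddenFrame.ray (f ⊓ n • (WObject.unit : G)) r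
  -- Since `L` is a `W`-kernel, `H` is archimedean with weak unit, as the truncation lemma requires.
  obtain ⟨H, _, θ, hθ⟩ := L.2
  rw [MaddenFrame.ray_le_iff_of_ker_eq hθ]
  intro p q hq hr
  refine WObject.nsmul_le_of_forall_nsmul_inf_nsmul_unit_le q fun n => ?_
  rw [← θ.map_inf_nsmul_unit]
  exact (MaddenFrame.ray_le_iff_of_ker_eq hθ).1
    (le_iSup (fun n : ℕ => MaddenFrame.ray (f ⊓ n • (WObject.unit : G)) r) n) p q hq hr

theorem proposition3 {G : Type u} [WObject G] (f : G) :
    IsPointwiseSup.{u, v} (Set.range fun n : ℕ => f ⊓ n • (WObject.unit : G)) f ∧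
      IsMaddenPointwiseSup (Set.range fun n : ℕ => f ⊓ n • (WObject.unit : G)) f :=
  ⟨isPointwiseSup_truncates f, isMaddenPointwiseSup_truncates f⟩
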